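/- A family of $k<mn$ vectors $|\phi_1\rangle,\dots,|\phi_k\rangle\in\mathbb{C}^m\otimes\mathbb{C}^n$ is called an unextendible product basis (UPB) if (i) every $|\phi_i\rangle$ is a product state, i.e. a nonzero vector of the form $|a\rangle\otimes|b\rangle$; (ii) $\langle\phi_i|\phi_j\rangle=\delta_{ij}$ for all $i,j$; and (iii) no product state is orthogonal to all of $|\phi_1\rangle,\dots,|\phi_k\rangle$. Its missing states number is $mn-k$. Let $m\ge 4$ and $n\ge 10$ be integers. Then for every integer $l$ with $4\le l\le (m-1)(n-8)$ there is a UPB in $\mathbb{C}^m\otimes\mathbb{C}^n$ with missing states number $l$. -/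

import Mathlib

open scoped TensorProduct

/-- The bipartite Hilbert space `ℂ^m ⊗ ℂ^n`, with Mathlib's inner product on the tensor product:
`⟪a ⊗ b, c ⊗ d⟫ = ⟪a, c⟫ * ⟪b, d⟫`. -/
abbrev Bipartite (m n : ℕ) : Type :=
  EuclideanSpace ℂ (Fin m) ⊗[ℂ] EuclideanSpace ℂ (Fin n)

/-- A product state, up to normalization: a nonzero vector of the form `a ⊗ b`. -/
def IsProductState {m n : ℕ} (ψ : Bipartite m n) : Prop :=
  ψ ≠ 0 ∧ ∃ (a : EuclideanSpace ℂ (Fin m)) (b : EuclideanSpace ℂ (Fin n)), ψ = a ⊗ₜ[ℂ] b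

/-- A `k`-member unextendible product basis (UPB) in `ℂ^m ⊗ ℂ^n`. -/
structure IsUPB {m n k : ℕ} (φ : Fin k → Bipartite m n) : Prop where
  card_lt : k < m * n
  isProductState : ∀ i, IsProductState (φ i)
  orthonormal : Orthonormal ℂ φ
  unextendible : ∀ ψ : Bipartite m n, (∀ i, inner ℂ (φ i) ψ = 0) → ¬ IsProductState ψ

/-- There is a UPB in `ℂ^m ⊗ ℂ^n` whose missing states number `m * n - k` (with `k` its number of
members) is `l`; the subtraction does not truncate, since a UPB has `k < m * n`. -/
def ExistsUPBWithMissing (m n l : ℕ) : Prop :=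
  ∃ (k : ℕ) (φ : Fin k → Bipartite m n), IsUPB φ ∧ m * n - k = l

/-- Vectors `a i : R → ℂ`, `b i : C → ℂ` whose products `a i ⊗ b i` are nonzero, pairwise
orthogonal, and orthogonal to no common product vector. -/
structure IsUnextendibleFamily {R C ι : Type} [Fintype R] [Fintype C]
    (a : ι → R → ℂ) (b : ι → C → ℂ) : Prop where
  left_ne_zero : ∀ i, a i ≠ 0
  right_ne_zero : ∀ i, b i ≠ 0
  orthogonal : ∀ i j, i ≠ j → star (a i) ⬝ᵥ a j = 0 ∨ star (b i) ⬝ᵥ b j = 0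
  unextendible : ∀ u v, (∀ i, star (a i) ⬝ᵥ u = 0 ∨ star (b i) ⬝ᵥ v = 0) → u = 0 ∨ v = 0

/-- An unextendible orthogonal product family in `ℂ^R ⊗ ℂ^C` whose span has codimension `l`.
Complete product bases are allowed, with `l = 0`. -/
def HasCodim (R C : Type) [Fintype R] [Fintype C] (l : ℕ) : Prop :=
  ∃ (ι : Type) (_ : Fintype ι) (a : ι → R → ℂ) (b : ι → C → ℂ),
    IsUnextendibleFamily a b ∧ Fintype.card ι + l = Fintype.card R * Fintype.card C

theorem HasCodim.swap {R C : Type} [Fintype R] [Fintype C] {l : ℕ} (H : HasCodim R C l) :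
    HasCodim C R l := by
  obtain ⟨ι, _, a, b, hab, hc⟩ := H
  exact ⟨ι, _, b, a, ⟨hab.right_ne_zero, hab.left_ne_zero, fun i j hij => (hab.orthogonal i j hij).symm,
    fun u v h => (hab.unextendible v u fun i => (h i).symm).symm⟩, by rw [hc, mul_comm]⟩

theorem HasCodim.zero (R C : Type) [Fintype R] [Fintype C] : HasCodim R C 0 := by
  classical
  refine ⟨R × C, inferInstance, fun p => Pi.single p.1 1, fun p => Pi.single p.2 1,
    ⟨fun p => by simp, fun p => by simp, ?_, ?_⟩, by simp⟩
  · rintro ⟨r, c⟩ ⟨r', c'⟩ h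
    by_cases hr : r = r'
    · subst hr
      right
      have : c ≠ c' := fun h' => h (by rw [h'])
      simp [this]
    · left
      simp [hr]
  · intro u v h
    by_contra! hcon
    obtain ⟨r, hr⟩ := Function.ne_iff.1 hcon.1
    obtain ⟨c, hc⟩ := Function.ne_iff.1 hcon.2
    have := h (r, c)
    simp at this
    tauto

theorem HasCodim.congr {R C R' C' : Type} [Fintype R] [Fintype C] [Fintype R'] [Fintype C']
    (e : R ≃ R') (f : C ≃ C') {l : ℕ} (H : HasCodim R C l) : HasCodim R' C' l := by
  obtain ⟨ι, _, a, b, hab, hc⟩ := H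
  have key : ∀ {X Y : Type} [Fintype X] [Fintype Y] (g : X ≃ Y) (x : X → ℂ) (y : Y → ℂ),
      star (x ∘ g.symm) ⬝ᵥ y = star x ⬝ᵥ (y ∘ g) := by
    intro X Y _ _ g x y
    simp only [dotProduct]
    rw [← Equiv.sum_comp g]
    simp
  refine ⟨ι, _, fun i => a i ∘ e.symm, fun i => b i ∘ f.symm, ⟨fun i h => ?_, fun i h => ?_, ?_, ?_⟩,
    by rw [hc, Fintype.card_congr e, Fintype.card_congr f]⟩
  · exact hab.left_ne_zero i (by ext x; simpa using congrFun h (e x))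
  · exact hab.right_ne_zero i (by ext x; simpa using congrFun h (f x))
  · intro i j hij
    simp only [key]
    simpa [Function.comp_assoc] using hab.orthogonal i j hij
  · intro u v h
    simp only [key] at h
    rcases hab.unextendible _ _ h with h | h
    · left; ext x; simpa using congrFun h (e.symm x)
    · right; ext x; simpa using congrFun h (f.symm x)

theorem HasCodim.sum_right {R C D : Type} [Fintype R] [Fintype C] [Fintype D] [Nonempty R]
    {l k : ℕ} (H : HasCodim R C l) (K : HasCodim R D k) : HasCodim R (C ⊕ D) (l + k) := by
  obtain ⟨ι, _, a, b, hab, hc⟩ := H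
  obtain ⟨κ, _, a', b', hab', hc'⟩ := K
  have dot : ∀ (x : C → ℂ) (y : D → ℂ) (v : C ⊕ D → ℂ), star (Sum.elim x y) ⬝ᵥ v =
      star x ⬝ᵥ (v ∘ Sum.inl) + star y ⬝ᵥ (v ∘ Sum.inr) := by
    intro x y v
    simp [dotProduct, Fintype.sum_sum_type]
  refine ⟨ι ⊕ κ, inferInstance, Sum.elim a a',
    Sum.elim (fun i => Sum.elim (b i) 0) (fun i => Sum.elim 0 (b' i)), ⟨?_, ?_, ?_, ?_⟩, ?_⟩
  · rintro (i | i)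
    · exact hab.left_ne_zero i
    · exact hab'.left_ne_zero i
  · rintro (i | i) h
    · exact hab.right_ne_zero i (by ext x; simpa using congrFun h (Sum.inl x))
    · exact hab'.right_ne_zero i (by ext x; simpa using congrFun h (Sum.inr x))
  · rintro (i | i) (j | j) hij
    · simpa [dot, Function.comp_def] using hab.orthogonal i j (fun h => hij (by rw [h]))
    · right; simp [dot, Function.comp_def, ← Pi.zero_def]
    · right; simp [dot, Function.comp_def, ← Pi.zero_def]
    · simpa [dot, Function.comp_def] using hab'.orthogonal i j (fun h => hij (by rw [h]))
  · intro u v h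
    by_cases hu : u = 0
    · exact Or.inl hu
    right
    have h1 := (hab.unextendible u (v ∘ Sum.inl) fun i => by simpa [dot] using h (Sum.inl i)).resolve_left hu
    have h2 := (hab'.unextendible u (v ∘ Sum.inr) fun i => by simpa [dot] using h (Sum.inr i)).resolve_left hu
    ext (x | x)
    · exact congrFun h1 x
    · exact congrFun h2 x
  · simp only [Fintype.card_sum]
    linarith [mul_add (Fintype.card R) (Fintype.card C) (Fintype.card D)]

/-- `HasCodim` for `ℂ^m ⊗ ℂ^n`. -/
def Attains (m n l : ℕ) : Prop := HasCodim (Fin m) (Fin n) l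

theorem Attains.swap {m n l : ℕ} (H : Attains m n l) : Attains n m l := HasCodim.swap H

theorem Attains.zero (m n : ℕ) : Attains m n 0 := HasCodim.zero _ _

theorem Attains.add_cols {m n n' l l' : ℕ} (hm : 0 < m) (H : Attains m n l) (H' : Attains m n' l') :
    Attains m (n + n') (l + l') :=
  haveI : Nonempty (Fin m) := ⟨⟨0, hm⟩⟩
  (HasCodim.sum_right H H').congr (Equiv.refl _) finSumFinEquiv

theorem Attains.add_rows {m m' n l l' : ℕ} (hn : 0 < n) (H : Attains m n l) (H' : Attains m' n l') :
    Attains (m + m') n (l + l') :=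
  (H.swap.add_cols hn H'.swap).swap

theorem Attains.mono {m m' n n' l : ℕ} (hm : 0 < m) (hn : 0 < n) (hmm : m ≤ m') (hnn : n ≤ n')
    (H : Attains m n l) : Attains m' n' l := by
  obtain ⟨x, rfl⟩ := Nat.exists_eq_add_of_le hmm
  obtain ⟨y, rfl⟩ := Nat.exists_eq_add_of_le hnn
  exact (H.add_rows hn (Attains.zero x n)).add_cols (by omega) (Attains.zero _ y)

theorem Attains.existsUPBWithMissing {m n l : ℕ} (hl : 0 < l) (H : Attains m n l) :
    ExistsUPBWithMissing m n l := by
  obtain ⟨ι, _, a, b, hab, hc⟩ := H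
  simp only [Fintype.card_fin] at hc
  let e := Fintype.equivFin ι
  let α : ι → EuclideanSpace ℂ (Fin m) := fun i => WithLp.toLp 2 (a i)
  let β : ι → EuclideanSpace ℂ (Fin n) := fun i => WithLp.toLp 2 (b i)
  have hα : ∀ i, α i ≠ 0 := fun i h => hab.left_ne_zero i (by simpa [α] using h)
  have hβ : ∀ i, β i ≠ 0 := fun i h => hab.right_ne_zero i (by simpa [β] using h)
  have inner_eq : ∀ {k : ℕ} (x y : EuclideanSpace ℂ (Fin k)),
      inner ℂ x y = star (WithLp.ofLp x) ⬝ᵥ WithLp.ofLp y := fun x y => by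
    rw [EuclideanSpace.inner_eq_star_dotProduct, dotProduct_comm]
  have horth : ∀ i (x : EuclideanSpace ℂ (Fin m)) (y : EuclideanSpace ℂ (Fin n)),
      inner ℂ (((‖α i‖ : ℂ)⁻¹ • α i) ⊗ₜ[ℂ] ((‖β i‖ : ℂ)⁻¹ • β i)) (x ⊗ₜ[ℂ] y) = 0 ↔
        star (a i) ⬝ᵥ WithLp.ofLp x = 0 ∨ star (b i) ⬝ᵥ WithLp.ofLp y = 0 := fun i x y => by
    rw [TensorProduct.inner_tmul, inner_smul_left, inner_smul_left, mul_eq_zero, mul_eq_zero,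
      mul_eq_zero, inner_eq, inner_eq]
    simp [hα i, hβ i, α, β]
  have hunit : ∀ i, ‖((‖α i‖ : ℂ)⁻¹ • α i) ⊗ₜ[ℂ] ((‖β i‖ : ℂ)⁻¹ • β i)‖ = 1 := fun i => by
    rw [TensorProduct.norm_tmul, norm_smul, norm_smul]
    simp [hα i, hβ i]
  refine ⟨Fintype.card ι, fun k => ((‖α (e.symm k)‖ : ℂ)⁻¹ • α (e.symm k)) ⊗ₜ[ℂ]
      ((‖β (e.symm k)‖ : ℂ)⁻¹ • β (e.symm k)),
    ⟨by omega, fun k => ⟨?_, _, _, rfl⟩, ⟨fun k => hunit _, fun k k' hk => ?_⟩, ?_⟩, by omega⟩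
  · intro h
    have := hunit (e.symm k)
    rw [h, norm_zero] at this
    exact zero_ne_one this
  · refine (horth _ _ _).2 ?_
    rcases hab.orthogonal _ _ (e.symm.injective.ne hk) with h | h
    · left
      rw [WithLp.ofLp_smul, dotProduct_smul, h, smul_zero]
    · right
      rw [WithLp.ofLp_smul, dotProduct_smul, h, smul_zero]
  · rintro ψ h ⟨h0, x, y, rfl⟩
    have := hab.unextendible (WithLp.ofLp x) (WithLp.ofLp y) fun i => by
      simpa using (horth (e.symm (e i)) x y).1 (h (e i))
    rcases this with h | h
    · exact h0 (by rw [(WithLp.ofLp_eq_zero 2).1 h, TensorProduct.zero_tmul])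
    · exact h0 (by rw [(WithLp.ofLp_eq_zero 2).1 h, TensorProduct.tmul_zero])

/-- Integer vectors with a decidable orthogonality check. -/
theorem attains_of_int {m n k l : ℕ} (a : Fin k → Fin m → ℤ) (b : Fin k → Fin n → ℤ)
    (ha : ∀ i, a i ≠ 0) (hb : ∀ i, b i ≠ 0)
    (hab : ∀ i j, i ≠ j → a i ⬝ᵥ a j = 0 ∨ b i ⬝ᵥ b j = 0) (hk : k + l = m * n)
    (hu : ∀ (u : Fin m → ℂ) (v : Fin n → ℂ),
      (∀ i, ∑ x, (a i x : ℂ) * u x = 0 ∨ ∑ y, (b i y : ℂ) * v y = 0) → u = 0 ∨ v = 0) :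
    Attains m n l := by
  have cast_ne : ∀ {p : ℕ} (x : Fin p → ℤ), x ≠ 0 → (fun i => (x i : ℂ)) ≠ 0 := fun x hx h =>
    hx (by ext i; simpa using congrFun h i)
  have cast_dot : ∀ {p : ℕ} (x y : Fin p → ℤ), x ⬝ᵥ y = 0 →
      star (fun i => (x i : ℂ)) ⬝ᵥ (fun i => (y i : ℂ)) = 0 := fun x y h => by
    simp only [dotProduct] at h
    simp only [dotProduct, Pi.star_apply, star_intCast]
    exact_mod_cast h
  refine ⟨Fin k, inferInstance, fun i x => (a i x : ℂ), fun i x => (b i x : ℂ),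
    ⟨fun i => cast_ne _ (ha i), fun i => cast_ne _ (hb i), fun i j hij => ?_, fun u v h => ?_⟩,
    by simpa using hk⟩
  · exact (hab i j hij).imp (cast_dot _ _) (cast_dot _ _)
  · exact hu u v fun i => by simpa [dotProduct] using h i

theorem attains_three_three : Attains 3 3 4 := by
  refine attains_of_int (k := 5)
    ![![1, 1, 1], ![1, 0, -1], ![1, -1, 0], ![0, 1, 0], ![0, 0, 1]]
    ![![1, 1, 1], ![0, 1, 0], ![0, 0, 1], ![1, -1, 0], ![1, 0, -1]]
    (by decide) (by decide) (by decide) rfl fun u v h => ?_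
  simp only [Fin.forall_fin_succ, Fin.sum_univ_succ] at h
  simp at h
  simp only [funext_iff, Fin.forall_fin_succ]
  simp
  grind

theorem attains_three_four : Attains 3 4 5 := by
  refine attains_of_int (k := 7)
    ![![1, 1, 1], ![1, 0, 0], ![1, 0, -1], ![1, -1, 0], ![0, 1, 0], ![0, 1, -1], ![0, 0, 1]]
    ![![1, 1, 1, 1], ![1, -1, 0, 0], ![0, 0, 1, 0], ![0, 0, 0, 1], ![1, 0, -1, 0], ![0, 1, 0, 0],
      ![1, 0, 0, -1]]
    (by decide) (by decide) (by decide) rfl fun u v h => ?_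
  simp only [Fin.forall_fin_succ, Fin.sum_univ_succ] at h
  simp at h
  simp only [funext_iff, Fin.forall_fin_succ]
  simp
  grind

theorem attains_four_four : Attains 4 4 7 := by
  refine attains_of_int (k := 9)
    ![![1, 1, 1, 1], ![1, 0, -1, 0], ![1, 0, 0, 0], ![1, -1, 0, 0], ![0, 1, 0, 0], ![0, 1, 0, -1],
      ![0, 0, 1, -1], ![0, 0, 1, 0], ![0, 0, 0, 1]]
    ![![1, 1, 1, 1], ![1, 0, 0, 0], ![0, 1, 0, -1], ![0, 0, 1, 0], ![1, -1, 0, 0], ![0, 0, 0, 1],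
      ![0, 1, 0, 0], ![0, 0, 1, -1], ![1, 0, -1, 0]]
    (by decide) (by decide) (by decide) rfl fun u v h => ?_
  simp only [Fin.forall_fin_succ, Fin.sum_univ_succ] at h
  simp at h
  simp only [funext_iff, Fin.forall_fin_succ]
  simp
  grind

open Polynomial in
/-- Points split into two classes, the first carrying rows `τ ^ j * z ^ j`, the second rows
`τ ^ (-j) * p j * z ^ j`: for small `τ` any `m` of the rows are independent, since after rescaling
they tend to a direct sum of two Vandermonde matrices. -/
theorem eventually_twisted_vandermonde_injective {ι : Type} {m : ℕ} (s : ι → Prop) (x : ι → ℂ)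
    (hx : Function.Injective x) (hx0 : ∀ i, x i ≠ 0) (p : Fin m → ℂ) (hp : ∀ j, p j ≠ 0)
    (T : Finset ι) (hT : T.card = m) :
    ∀ᶠ τ : ℝ in nhdsWithin 0 (Set.Ioi 0), ∀ u : Fin m → ℂ,
      (∀ i ∈ T, s i → ∑ j : Fin m, (τ : ℂ) ^ (j : ℕ) * x i ^ (j : ℕ) * u j = 0) →
      (∀ i ∈ T, ¬ s i → ∑ j : Fin m, ((τ : ℂ) ^ (j : ℕ))⁻¹ * (p j * x i ^ (j : ℕ)) * u j = 0) → u = 0 := by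
  classical
  set k := (T.filter s).card with hk
  have hk' : (T.filter fun i => ¬ s i).card = m - k := by
    have := Finset.card_filter_add_card_filter_not (s := T) s
    omega
  let e : Fin m ≃ T := (finCongr hT.symm).trans T.equivFin.symm
  let M : ℝ → Matrix (Fin m) (Fin m) ℂ := fun τ r j =>
    if s (e r) then (if (j : ℕ) < k then 1 else (τ : ℂ) ^ (2 * (j - k) + 1)) * x (e r) ^ (j : ℕ)
    else (if (j : ℕ) < k then (τ : ℂ) ^ (2 * (k - 1 - j) + 1) else 1) * (p j * x (e r) ^ (j : ℕ))
  have hM0 : (M 0).det ≠ 0 := by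
    intro hdet
    obtain ⟨v, hv0, hv⟩ := Matrix.exists_mulVec_eq_zero_iff.2 hdet
    apply hv0
    have hrow : ∀ i (hi : i ∈ T), ∑ j, M 0 (e.symm ⟨i, hi⟩) j * v j = 0 := fun i hi =>
      congrFun hv (e.symm ⟨i, hi⟩)
    let A : ℂ[X] := ∑ j : Fin m, if (j : ℕ) < k then C (v j) * X ^ (j : ℕ) else 0
    let B : ℂ[X] := ∑ j : Fin m, if (j : ℕ) < k then 0 else C (p j * v j) * X ^ (j - k : ℕ)
    have hA : A = 0 := by
      refine eq_zero_of_degree_lt_of_eval_index_eq_zero (s := T.filter s) (v := x) hx.injOn ?_ ?_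
      · rw [← hk, degree_lt_iff_coeff_zero]
        intro t ht
        simp only [A, finsetSum_coeff]
        refine Finset.sum_eq_zero fun j _ => ?_
        split_ifs with hj
        · rw [coeff_C_mul, coeff_X_pow, if_neg (by omega), mul_zero]
        · simp
      · intro i hi
        rw [Finset.mem_filter] at hi
        rw [← hrow i hi.1]
        simp only [A, M, eval_finsetSum]
        refine Finset.sum_congr rfl fun j _ => ?_
        simp only [Equiv.apply_symm_apply, hi.2, if_true]
        split_ifs with hj
        · rw [eval_mul, eval_C, eval_pow, eval_X]
          ring
        · simp
    have hB : B = 0 := by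
      refine eq_zero_of_degree_lt_of_eval_index_eq_zero (s := T.filter fun i => ¬ s i) (v := x) hx.injOn
        ?_ ?_
      · rw [hk', degree_lt_iff_coeff_zero]
        intro t ht
        simp only [B, finsetSum_coeff]
        refine Finset.sum_eq_zero fun j _ => ?_
        split_ifs with hj
        · simp
        · rw [coeff_C_mul, coeff_X_pow, if_neg (by omega), mul_zero]
      · intro i hi
        rw [Finset.mem_filter] at hi
        refine (mul_eq_zero.1 ?_).resolve_left (pow_ne_zero k (hx0 i))
        rw [← hrow i hi.1]
        simp only [B, M, eval_finsetSum, Finset.mul_sum]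
        refine Finset.sum_congr rfl fun j _ => ?_
        simp only [Equiv.apply_symm_apply, hi.2, if_false]
        split_ifs with hj
        · simp
        · obtain ⟨d, hd⟩ := Nat.exists_eq_add_of_le (not_lt.1 hj)
          rw [hd]
          simp [pow_add]
          ring
    ext j
    by_cases hj : (j : ℕ) < k
    · have := congrArg (fun f => coeff f j) hA
      simp only [A, finsetSum_coeff, coeff_zero] at this
      rw [Finset.sum_eq_single j] at this
      · simpa [hj] using this
      · intro i _ hij
        split_ifs
        · rw [coeff_C_mul, coeff_X_pow, if_neg (fun h => hij (Fin.ext h.symm)), mul_zero]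
        · simp
      · simp
    · have := congrArg (fun f => coeff f (j - k)) hB
      simp only [B, finsetSum_coeff, coeff_zero] at this
      rw [Finset.sum_eq_single j] at this
      · rw [if_neg hj, coeff_C_mul, coeff_X_pow_self, mul_one] at this
        exact (mul_eq_zero.1 this).resolve_left (hp j)
      · intro i _ hij
        split_ifs with hi
        · simp
        · rw [coeff_C_mul, coeff_X_pow, if_neg (fun h => hij (Fin.ext (by omega))), mul_zero]
      · simp
  have hcont : Continuous fun τ => (M τ).det := by
    refine Continuous.matrix_det (continuous_matrix fun r j => ?_)
    simp only [M]
    split_ifs <;> fun_prop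
  have hev : ∀ᶠ τ : ℝ in nhdsWithin 0 (Set.Ioi 0), (M τ).det ≠ 0 :=
    nhdsWithin_le_nhds (hcont.continuousAt.eventually_ne hM0)
  filter_upwards [hev, self_mem_nhdsWithin] with τ hdet hτ u hu1 hu2
  have hτ0 : (τ : ℂ) ≠ 0 := by exact_mod_cast (Set.mem_Ioi.1 hτ).ne'
  let v : Fin m → ℂ := fun j =>
    if (j : ℕ) < k then τ ^ (j : ℕ) * u j else τ ^ (2 * k) / τ ^ (j + 1 : ℕ) * u j
  have hv : (M τ).mulVec v = 0 := by
    ext r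
    simp only [Matrix.mulVec, dotProduct, Pi.zero_apply, M]
    by_cases hs : s (e r)
    · rw [← hu1 _ (e r).2 hs]
      refine Finset.sum_congr rfl fun j _ => ?_
      simp only [hs, if_true, v]
      split_ifs with hj
      · ring
      · obtain ⟨d, hd⟩ := Nat.exists_eq_add_of_le (not_lt.1 hj)
        rw [hd, Nat.add_sub_cancel_left]
        field_simp
        ring
    · rw [← mul_zero ((τ : ℂ) ^ (2 * k) / τ), ← hu2 _ (e r).2 hs, Finset.mul_sum]
      refine Finset.sum_congr rfl fun j _ => ?_
      simp only [hs, if_false, v]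
      split_ifs with hj
      · obtain ⟨d, hd⟩ := Nat.exists_eq_add_of_le (Nat.succ_le_of_lt hj)
        have : k - 1 - (j : ℕ) = d := by omega
        rw [this, hd, Nat.succ_eq_add_one]
        field_simp
        ring
      · field_simp
        ring
  have hv0 : v = 0 := by
    by_contra hne
    exact hdet (Matrix.exists_mulVec_eq_zero_iff.1 ⟨v, hne, hv⟩)
  ext j
  have := congrFun hv0 j
  simp only [v] at this
  split_ifs at this with hj
  · simpa [hτ0] using this
  · simpa [hτ0] using this

open Polynomial in
/-- A product family indexed by the `2h`-th roots of unity `z`: the right vectors are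
`(√(W.coeff j) * z ^ j)`, the left vectors `(τ ^ j * z ^ j)` if `z ^ h = 1`, and
`(τ ^ (-j) * P.coeff j * z ^ j)` if `z ^ h = -1`. -/
theorem attains_of_polynomials {h m n l : ℕ} (hh : 0 < h) (hm : 0 < m) (hn : 0 < n)
    (hmn : m + n = 2 * h + 1) (hl : 2 * h + l = m * n) (P : ℂ[X]) (W : ℝ[X])
    (hPd : P.natDegree < m) (hP : ∀ j < m, P.coeff j ≠ 0)
    (hWd : W.natDegree < n) (hW : ∀ j < n, 0 < W.coeff j)
    (hW1 : ∀ z : ℂ, z ^ h = 1 → z ≠ 1 → aeval z W = 0)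
    (hPW : ∀ z : ℂ, z ^ h = -1 → P.eval z = 0 ∨ aeval z W = 0) :
    Attains m n l := by
  classical
  let ι : Type := nthRootsFinset (2 * h) (1 : ℂ)
  have hι : Fintype.card ι = 2 * h := by
    simp only [ι, Fintype.card_coe]
    exact (Complex.isPrimitiveRoot_exp (2 * h) (by omega)).card_nthRootsFinset
  have hz : ∀ z : ι, (z : ℂ) ^ (2 * h) = 1 := fun z =>
    (mem_nthRootsFinset (by omega) _).1 z.2
  have hz0 : ∀ z : ι, (z : ℂ) ≠ 0 := fun z h0 => by
    have := hz z
    rw [h0, zero_pow (by omega)] at this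
    exact zero_ne_one this
  have hzh : ∀ z : ι, (z : ℂ) ^ h = 1 ∨ (z : ℂ) ^ h = -1 := fun z => by
    rw [← sq_eq_one_iff, ← pow_mul']
    exact hz z
  have hconj : ∀ z : ι, star (z : ℂ) * z = 1 := fun z => by
    have : ‖(z : ℂ)‖ = 1 := Complex.norm_eq_one_of_pow_eq_one (hz z) (by omega)
    have h2 := Complex.conj_mul' (z : ℂ)
    rw [this] at h2
    simpa using h2
  let x : ι → ℂ := fun z => star (z : ℂ)
  have hx : Function.Injective x := fun z w hzw => Subtype.ext (star_injective hzw)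
  obtain ⟨τ, hτev, hτ⟩ : ∃ τ : ℝ, _ := ((Filter.eventually_all.2 fun T : {T : Finset ι // T.card = m} =>
    eventually_twisted_vandermonde_injective (fun z : ι => (z : ℂ) ^ h = 1) x hx
      (fun z => star_ne_zero.2 (hz0 z)) (fun j : Fin m => star (P.coeff j))
      (fun j => star_ne_zero.2 (hP j j.2)) T.1 T.2).and self_mem_nhdsWithin).exists
  have hτ0 : (τ : ℂ) ≠ 0 := by exact_mod_cast (Set.mem_Ioi.1 hτ).ne'
  let a : ι → Fin m → ℂ := fun z j =>
    if (z : ℂ) ^ h = 1 then (τ : ℂ) ^ (j : ℕ) * (z : ℂ) ^ (j : ℕ)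
    else ((τ : ℂ) ^ (j : ℕ))⁻¹ * (P.coeff j * (z : ℂ) ^ (j : ℕ))
  let b : ι → Fin n → ℂ := fun z j => (√(W.coeff j) : ℝ) * (z : ℂ) ^ (j : ℕ)
  have hpos : ∀ z w : ι, z ≠ w → star (z : ℂ) * w ≠ 1 := fun z w hzw h1 => hzw <| by
    have h2 : star (z : ℂ) * w = star (z : ℂ) * z := by rw [h1, hconj]
    exact Subtype.ext (mul_left_cancel₀ (star_ne_zero.2 (hz0 z)) h2).symm
  have hbdot : ∀ z w : ι, star (b z) ⬝ᵥ b w = aeval (star (z : ℂ) * w) W := by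
    intro z w
    rw [aeval_eq_sum_range' hWd, ← Fin.sum_univ_eq_sum_range
      (fun j => W.coeff j • (star (z : ℂ) * w) ^ j)]
    refine Finset.sum_congr rfl fun j _ => ?_
    have : ((√(W.coeff j) : ℝ) : ℂ) * (√(W.coeff j) : ℝ) = (W.coeff j : ℝ) := by
      rw [← Complex.ofReal_mul, Real.mul_self_sqrt (hW j j.2).le]
    simp only [Pi.star_apply, b, star_mul', star_pow, mul_pow, Complex.real_smul, ← this]
    simp
    ring
  have hadot : ∀ z w : ι, (z : ℂ) ^ h = 1 → ¬ (w : ℂ) ^ h = 1 →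
      star (a z) ⬝ᵥ a w = P.eval (star (z : ℂ) * w) := by
    intro z w h1 h2
    rw [eval_eq_sum_range' hPd, ← Fin.sum_univ_eq_sum_range
      (fun j => P.coeff j * (star (z : ℂ) * w) ^ j)]
    refine Finset.sum_congr rfl fun j _ => ?_
    simp only [Pi.star_apply, a, h1, h2, if_true, if_false, star_mul', star_pow, mul_pow]
    simp
    field_simp
  have hstar : ∀ {k : ℕ} (y y' : Fin k → ℂ), star y ⬝ᵥ y' = 0 → star y' ⬝ᵥ y = 0 := by
    intro k y y' h0
    rw [dotProduct_comm, ← star_star (y ⬝ᵥ star y'), ← Matrix.star_dotProduct_star, star_star, dotProduct_comm, h0, star_zero]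
  have horth : ∀ z w : ι, (z : ℂ) ^ h = 1 → ¬ (w : ℂ) ^ h = 1 →
      star (a z) ⬝ᵥ a w = 0 ∨ star (b z) ⬝ᵥ b w = 0 := by
    intro z w h1 h2
    rw [hadot z w h1 h2, hbdot]
    refine hPW _ ?_
    rw [mul_pow, ← star_pow, h1, (hzh w).resolve_left h2]
    simp
  refine ⟨ι, inferInstance, a, b, ⟨fun z h0 => ?_, fun z h0 => ?_, fun z w hzw => ?_, fun u v huv => ?_⟩,
    by simpa [hι] using hl⟩
  · have := congrFun h0 ⟨0, hm⟩
    simp only [a] at this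
    split_ifs at this <;> simp [hP 0 hm] at this
  · have := congrFun h0 ⟨0, hn⟩
    simp [b, (Real.sqrt_pos.2 (hW 0 hn)).ne'] at this
  · by_cases h1 : (z : ℂ) ^ h = 1 <;> by_cases h2 : (w : ℂ) ^ h = 1
    · right
      rw [hbdot]
      refine hW1 _ ?_ (hpos z w hzw)
      rw [mul_pow, ← star_pow, h1, h2]; simp
    · exact horth z w h1 h2
    · exact (horth w z h2 h1).imp (hstar _ _) (hstar _ _)
    · right
      rw [hbdot]
      refine hW1 _ ?_ (hpos z w hzw)
      rw [mul_pow, ← star_pow, (hzh z).resolve_left h1, (hzh w).resolve_left h2]; simp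
  · by_cases hv : v = 0
    · exact Or.inr hv
    left
    let Sa : Finset ι := Finset.univ.filter fun z => star (a z) ⬝ᵥ u = 0
    let Sb : Finset ι := Finset.univ.filter fun z => star (b z) ⬝ᵥ v = 0
    have hSab : 2 * h ≤ Sa.card + Sb.card := by
      rw [← hι, ← Finset.card_univ]
      refine le_trans (Finset.card_le_card fun z _ => ?_) (Finset.card_union_le Sa Sb)
      simpa [Sa, Sb] using huv z
    have hSb : Sb.card < n := by
      by_contra! hcard
      let B : ℂ[X] := ∑ j : Fin n, C ((√(W.coeff j) : ℝ) * v j) * X ^ (j : ℕ)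
      have hB : B = 0 := by
        refine eq_zero_of_degree_lt_of_eval_index_eq_zero (s := Sb) (v := x) hx.injOn
          ((degree_sum_fin_lt _).trans_le (by exact_mod_cast hcard)) fun z hz => ?_
        rw [← (Finset.mem_filter.1 hz).2]
        simp only [B, eval_finsetSum, dotProduct]
        refine Finset.sum_congr rfl fun j _ => ?_
        simp [b, x]
        ring
      apply hv
      ext j
      have := congrArg (fun f => coeff f j) hB
      simp only [B, finsetSum_coeff, coeff_zero] at this
      rw [Finset.sum_eq_single j] at this
      · rw [coeff_C_mul, coeff_X_pow_self, mul_one] at this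
        exact (mul_eq_zero.1 this).resolve_left (by exact_mod_cast (Real.sqrt_pos.2 (hW j j.2)).ne')
      · intro i _ hij
        rw [coeff_C_mul, coeff_X_pow, if_neg (fun h => hij (Fin.ext h.symm)), mul_zero]
      · simp
    obtain ⟨T, hTS, hT⟩ := Finset.exists_subset_card_eq (show m ≤ Sa.card by omega)
    refine hτev ⟨T, hT⟩ u (fun z hz h1 => ?_) (fun z hz h1 => ?_)
    · rw [← (Finset.mem_filter.1 (hTS hz)).2]
      refine Finset.sum_congr rfl fun j _ => ?_
      simp [a, h1, x]
    · rw [← (Finset.mem_filter.1 (hTS hz)).2]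
      refine Finset.sum_congr rfl fun j _ => ?_
      simp [a, h1, x]

theorem Real.sin_lt_sin_of_add_lt_pi {a b : ℝ} (ha : 0 ≤ a) (hab : a < b) (h : a + b < Real.pi) :
    Real.sin a < Real.sin b := by
  rcases le_total b (Real.pi / 2) with hb | hb
  · exact Real.sin_lt_sin_of_lt_of_le_pi_div_two (by linarith [Real.pi_pos]) hb hab
  · rw [← Real.sin_pi_sub b]
    exact Real.sin_lt_sin_of_lt_of_le_pi_div_two (by linarith [Real.pi_pos]) (by linarith)
      (by linarith)

theorem sin_mul_pi_div_pos {h : ℕ} {x : ℝ} (hx : 0 < x) (hxh : x < h) :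
    0 < Real.sin (x * (Real.pi / h)) := by
  have hh : (0 : ℝ) < h := hx.trans hxh
  refine Real.sin_pos_of_pos_of_lt_pi (by positivity) ?_
  rw [← mul_div_assoc, div_lt_iff₀ hh, mul_comm]
  exact mul_lt_mul_of_pos_left hxh Real.pi_pos

/-- The symmetric Gaussian binomial coefficients `[M choose j]` at `q = exp (2πi/h)`. -/
noncomputable def gaussCoeff (h M : ℕ) : ℕ → ℝ
  | 0 => 1
  | j + 1 => gaussCoeff h M j * Real.sin ((M - j) * (Real.pi / h)) /
      Real.sin ((j + 1) * (Real.pi / h))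

theorem gaussCoeff_pos {h M : ℕ} (hM : M < h) : ∀ j ≤ M, 0 < gaussCoeff h M j
  | 0, _ => one_pos
  | j + 1, hj => by
    have h1 : (j : ℝ) + 1 ≤ M := by exact_mod_cast hj
    have h2 : (M : ℝ) < h := by exact_mod_cast hM
    exact div_pos (mul_pos (gaussCoeff_pos hM j (by omega))
      (sin_mul_pi_div_pos (by linarith) (by linarith [Nat.cast_nonneg (α := ℝ) j])))
      (sin_mul_pi_div_pos (by positivity) (by linarith))

theorem gaussCoeff_eq_zero (h M : ℕ) : ∀ j, M < j → gaussCoeff h M j = 0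
  | 0, hj => absurd hj (by omega)
  | j + 1, hj => by
    rcases (Nat.lt_succ_iff.1 hj).eq_or_lt with rfl | hj'
    · simp [gaussCoeff]
    · rw [gaussCoeff, gaussCoeff_eq_zero h M j hj']
      simp

theorem gaussCoeff_succ_mul_sin {h M : ℕ} (hM : M < h) (j : ℕ) :
    gaussCoeff h M (j + 1) * Real.sin ((j + 1) * (Real.pi / h)) =
      gaussCoeff h M j * Real.sin ((M - j) * (Real.pi / h)) := by
  rcases lt_or_ge j M with hj | hj
  · have h1 : (j : ℝ) + 1 < h := by exact_mod_cast (by omega : j + 1 < h)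
    have := (sin_mul_pi_div_pos (h := h) (x := j + 1) (by positivity) h1).ne'
    rw [gaussCoeff, div_mul_cancel₀ _ this]
  · rw [gaussCoeff_eq_zero h M (j + 1) (by omega)]
    rcases hj.eq_or_lt with rfl | hj'
    · simp
    · rw [gaussCoeff_eq_zero h M j hj']
      simp

theorem gaussCoeff_lt_succ {h M j : ℕ} (hM : M + 1 < h) (hj : 2 * j + 1 < M) :
    gaussCoeff h M j < gaussCoeff h M (j + 1) := by
  have hh : (0 : ℝ) < h := by exact_mod_cast (by omega : 0 < h)
  have hM' : (M : ℝ) + 1 < h := by exact_mod_cast hM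
  have hj' : 2 * (j : ℝ) + 1 < M := by exact_mod_cast hj
  have hrec := gaussCoeff_succ_mul_sin (by omega : M < h) j
  have hpos := gaussCoeff_pos (by omega : M < h) j (by omega)
  have hs : Real.sin ((j + 1) * (Real.pi / h)) < Real.sin ((M - j) * (Real.pi / h)) := by
    refine Real.sin_lt_sin_of_add_lt_pi (by positivity)
      (mul_lt_mul_of_pos_right (by linarith) (by positivity)) ?_
    rw [← add_mul, ← mul_div_assoc, div_lt_iff₀ hh, mul_comm]
    exact mul_lt_mul_of_pos_left (by linarith) Real.pi_pos
  have hs0 : 0 < Real.sin ((j + 1) * (Real.pi / h)) :=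
    sin_mul_pi_div_pos (by positivity) (by linarith [Nat.cast_nonneg (α := ℝ) j])
  refine lt_of_mul_lt_mul_right ?_ hs0.le
  rw [hrec]
  exact mul_lt_mul_of_pos_left hs hpos

theorem gaussCoeff_succ_lt {h M j : ℕ} (hM : M + 1 < h) (hj : M < 2 * j + 1) (hjM : j < M) :
    gaussCoeff h M (j + 1) < gaussCoeff h M j := by
  have hh : (0 : ℝ) < h := by exact_mod_cast (by omega : 0 < h)
  have hM' : (M : ℝ) + 1 < h := by exact_mod_cast hM
  have hj' : (M : ℝ) < 2 * j + 1 := by exact_mod_cast hj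
  have hjM' : (j : ℝ) < M := by exact_mod_cast hjM
  have hrec := gaussCoeff_succ_mul_sin (by omega : M < h) j
  have hpos := gaussCoeff_pos (by omega : M < h) j (by omega)
  have hs : Real.sin ((M - j) * (Real.pi / h)) < Real.sin ((j + 1) * (Real.pi / h)) := by
    refine Real.sin_lt_sin_of_add_lt_pi (mul_nonneg (by linarith) (by positivity))
      (mul_lt_mul_of_pos_right (by linarith) (by positivity)) ?_
    rw [← add_mul, ← mul_div_assoc, div_lt_iff₀ hh, mul_comm]
    exact mul_lt_mul_of_pos_left (by linarith) Real.pi_pos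
  have hs0 : 0 < Real.sin ((j + 1) * (Real.pi / h)) :=
    sin_mul_pi_div_pos (by positivity) (by linarith)
  refine lt_of_mul_lt_mul_right ?_ hs0.le
  rw [hrec]
  exact mul_lt_mul_of_pos_left hs hpos

open Polynomial

/-- The Gaussian binomial polynomial `∑ j, [M choose j] X ^ j` at `q = exp (2πi/h)`. -/
noncomputable def gaussPoly (h M : ℕ) : ℝ[X] :=
  ∑ j ∈ Finset.range (M + 1), C (gaussCoeff h M j) * X ^ j

theorem coeff_gaussPoly (h M j : ℕ) : (gaussPoly h M).coeff j = gaussCoeff h M j := by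
  simp only [gaussPoly, finsetSum_coeff, coeff_C_mul, coeff_X_pow, mul_ite, mul_one, mul_zero,
    Finset.sum_ite_eq, Finset.mem_range]
  split_ifs with hj
  · rfl
  · exact (gaussCoeff_eq_zero h M j (by omega)).symm

theorem natDegree_gaussPoly_le (h M : ℕ) : (gaussPoly h M).natDegree ≤ M :=
  natDegree_le_iff_coeff_eq_zero.2 fun j hj => by
    rw [coeff_gaussPoly, gaussCoeff_eq_zero h M j hj]

/-- The root of unity `exp (πi/h)`. -/
noncomputable def halfRoot (h : ℕ) : ℂ := Complex.exp ((Real.pi / h : ℝ) * Complex.I)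

theorem halfRoot_ne_zero (h : ℕ) : halfRoot h ≠ 0 := Complex.exp_ne_zero _

theorem halfRoot_pow (h : ℕ) (hh : 0 < h) : halfRoot h ^ h = -1 := by
  have : (h : ℂ) ≠ 0 := by exact_mod_cast hh.ne'
  rw [halfRoot, ← Complex.exp_nat_mul, ← Complex.exp_pi_mul_I]
  congr 1
  push_cast
  field_simp

theorem isPrimitiveRoot_halfRoot_sq (h : ℕ) (hh : 0 < h) : IsPrimitiveRoot (halfRoot h ^ 2) h := by
  convert Complex.isPrimitiveRoot_exp h hh.ne' using 1
  rw [halfRoot, ← Complex.exp_nat_mul]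
  congr 1
  push_cast
  ring

theorem halfRoot_pow_sub_one (h k : ℕ) : halfRoot h ^ (2 * k) - 1 =
    2 * Complex.I * Real.sin (k * (Real.pi / h)) * halfRoot h ^ k := by
  have h1 : halfRoot h ^ k = Complex.exp (((k * (Real.pi / h) : ℝ) : ℂ) * Complex.I) := by
    rw [halfRoot, ← Complex.exp_nat_mul]
    congr 1
    push_cast
    ring
  have h3 : Complex.exp (-((k * (Real.pi / h) : ℝ) : ℂ) * Complex.I) *
      Complex.exp (((k * (Real.pi / h) : ℝ) : ℂ) * Complex.I) = 1 := by
    rw [← Complex.exp_add]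
    simp
  rw [mul_comm 2 k, pow_mul, h1, Complex.ofReal_sin, Complex.sin]
  linear_combination -Complex.I ^ 2 * h3 +
    (Complex.exp (((k * (Real.pi / h) : ℝ) : ℂ) * Complex.I) ^ 2 - 1) * Complex.I_sq

theorem gaussPoly_functional_equation {h M : ℕ} (hM : M < h) (z : ℂ) :
    (halfRoot h ^ (M + 1) * z + halfRoot h ^ (2 * M)) * aeval (halfRoot h ^ 2 * z) (gaussPoly h M) =
      halfRoot h ^ (2 * M) * (halfRoot h ^ (M + 1) * z + 1) * aeval z (gaussPoly h M) := by
  set E := halfRoot h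
  set f := (gaussPoly h M).map (algebraMap ℝ ℂ) with hf
  have hcoef : ∀ j, f.coeff j = (gaussCoeff h M j : ℂ) := fun j => by
    rw [hf, coeff_map, coeff_gaussPoly]; rfl
  have key : (C (E ^ (M + 1)) * X + C (E ^ (2 * M))) * f.comp (C (E ^ 2) * X) =
      C (E ^ (2 * M)) * (C (E ^ (M + 1)) * X + 1) * f := by
    ext (_ | j)
    · simp only [add_mul, mul_add, mul_assoc, coeff_add, mul_coeff_zero, coeff_X_zero,
        comp_C_mul_X_coeff, one_mul]
      simp
    · have hrec : (gaussCoeff h M (j + 1) : ℂ) * (E ^ (2 * (j + 1)) - 1) * E ^ (2 * M) =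
          gaussCoeff h M j * E ^ (M + 1) * (E ^ (2 * M) - E ^ (2 * j)) := by
        rcases le_or_gt j M with hj | hj
        · obtain ⟨d, rfl⟩ := Nat.exists_eq_add_of_le hj
          have e1 : E ^ (2 * (j + d)) - E ^ (2 * j) = E ^ (2 * j) * (E ^ (2 * d) - 1) := by ring
          have e2 := gaussCoeff_succ_mul_sin hM j
          rw [e1, halfRoot_pow_sub_one, halfRoot_pow_sub_one]
          have e3 : ((gaussCoeff h (j + d) (j + 1) : ℝ) : ℂ) *
              (Real.sin (((j + 1 : ℕ) : ℝ) * (Real.pi / h)) : ℝ) =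
              (gaussCoeff h (j + d) j : ℝ) * (Real.sin (d * (Real.pi / h)) : ℝ) := by
            rw [← Complex.ofReal_mul, ← Complex.ofReal_mul]
            congr 1
            push_cast at e2 ⊢
            rw [e2]
            congr 3
            ring
          calc _ = (((gaussCoeff h (j + d) (j + 1) : ℝ) : ℂ) *
              (Real.sin (((j + 1 : ℕ) : ℝ) * (Real.pi / h)) : ℝ)) *
                (2 * Complex.I * E ^ (j + 1) * E ^ (2 * (j + d))) := by ring
            _ = _ := by rw [e3]; ring
        · rw [gaussCoeff_eq_zero h M j hj, gaussCoeff_eq_zero h M (j + 1) (by omega)]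
          simp
      simp only [add_mul, mul_add, mul_assoc, coeff_add, coeff_C_mul, coeff_X_mul,
        comp_C_mul_X_coeff, hcoef, one_mul]
      linear_combination hrec
  have := congrArg (eval z) key
  simpa [hf, eval_comp, eval_map_algebraMap] using this

theorem aeval_gaussPoly_eq_zero {h M : ℕ} (hM : M < h) : ∀ i < M, ∀ z : ℂ,
    halfRoot h ^ (M + 1) * z = -halfRoot h ^ (2 * (i + 1)) → aeval z (gaussPoly h M) = 0 := by
  have hh : 0 < h := by omega
  have hE := halfRoot_ne_zero h
  have hne : ∀ i < M, halfRoot h ^ (2 * M) - halfRoot h ^ (2 * i) ≠ 0 := by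
    intro i hi h0
    rw [sub_eq_zero, pow_mul, pow_mul] at h0
    exact hi.ne' ((isPrimitiveRoot_halfRoot_sq h hh).pow_inj hM (by omega) h0)
  intro i
  induction i with
  | zero =>
    intro hi z hz
    have hfe := gaussPoly_functional_equation hM (z / halfRoot h ^ 2)
    rw [mul_div_cancel₀ _ (pow_ne_zero 2 hE)] at hfe
    have h1 : halfRoot h ^ (M + 1) * (z / halfRoot h ^ 2) = -1 := by
      rw [← mul_div_assoc, hz]
      field_simp
    rw [h1, neg_add_cancel, mul_zero, zero_mul, mul_eq_zero] at hfe
    refine hfe.resolve_left fun h0 => hne 0 hi ?_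
    linear_combination h0
  | succ i ih =>
    intro hi z hz
    have hfe := gaussPoly_functional_equation hM (z / halfRoot h ^ 2)
    rw [mul_div_cancel₀ _ (pow_ne_zero 2 hE)] at hfe
    have h1 : halfRoot h ^ (M + 1) * (z / halfRoot h ^ 2) = -halfRoot h ^ (2 * (i + 1)) := by
      rw [← mul_div_assoc, hz]
      field_simp
      ring
    rw [ih (by omega) _ h1, h1, mul_zero, mul_eq_zero] at hfe
    refine hfe.resolve_left fun h0 => hne (i + 1) hi ?_
    linear_combination h0

/-- The roots of `gaussPoly h (2 * s)`, negated, and those of `gaussPoly h (h - 2 * s)` exhaust the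
`h`-th roots of `-1`. -/
theorem aeval_gaussPoly_eq_zero_or {h s : ℕ} (hs : 0 < s) (hsh : 2 * s < h) {z : ℂ}
    (hz : z ^ h = -1) :
    aeval (-z) (gaussPoly h (2 * s)) = 0 ∨ aeval z (gaussPoly h (h - 2 * s)) = 0 := by
  have hh : 0 < h := by omega
  have hE := halfRoot_ne_zero h
  have hy : (halfRoot h ^ (2 * s + 1) * z) ^ h = 1 := by
    rw [mul_pow, ← pow_mul, mul_comm, mul_comm (2 * s + 1) h, pow_mul, halfRoot_pow h hh, hz,
      pow_succ, pow_mul]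
    simp
  obtain ⟨t, ht, hty⟩ : ∃ t < h, halfRoot h ^ (2 * (t + 1)) = halfRoot h ^ (2 * s + 1) * z := by
    have : NeZero h := ⟨hh.ne'⟩
    obtain ⟨t, ht, hty⟩ := (isPrimitiveRoot_halfRoot_sq h hh).eq_pow_of_pow_eq_one hy
    rcases t with _ | t
    · refine ⟨h - 1, by omega, ?_⟩
      rw [← hty, Nat.sub_add_cancel hh, mul_comm, pow_mul, halfRoot_pow h hh]
      simp
    · exact ⟨t, by omega, by rw [← hty, pow_mul]⟩
  rcases lt_or_ge t (2 * s) with hts | hts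
  · left
    refine aeval_gaussPoly_eq_zero hsh t hts _ ?_
    rw [hty]
    ring
  · right
    obtain ⟨d, rfl⟩ := Nat.exists_eq_add_of_le hts
    refine aeval_gaussPoly_eq_zero (by omega) d (by omega) z ?_
    have h1 : halfRoot h ^ (h - 2 * s + 1) * halfRoot h ^ (4 * s) =
        -halfRoot h ^ (2 * s + 1) := by
      rw [← pow_add, show h - 2 * s + 1 + 4 * s = h + (2 * s + 1) by omega, pow_add,
        halfRoot_pow h hh, neg_one_mul]
    have h2 : halfRoot h ^ (2 * (2 * s + d + 1)) = halfRoot h ^ (2 * (d + 1)) * halfRoot h ^ (4 * s) := by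
      rw [← pow_add]
      congr 1
      ring
    refine mul_right_cancel₀ (pow_ne_zero (4 * s) hE) ?_
    linear_combination z * h1 + hty - h2

theorem coeff_geom_sum (h j : ℕ) :
    (∑ i ∈ Finset.range h, (X : ℝ[X]) ^ i).coeff j = if j < h then 1 else 0 := by
  simp [finsetSum_coeff, coeff_X_pow]

theorem coeff_geom_sum_mul_pos {h d : ℕ} (hh : 0 < h) (f : ℝ[X])
    (hf : ∀ j < d, 0 < f.coeff j) (hd : f.natDegree < d) {j : ℕ} (hj : j + 1 < h + d) :
    0 < ((∑ i ∈ Finset.range h, X ^ i) * f).coeff j := by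
  rw [coeff_mul]
  refine Finset.sum_pos' (fun x _ => mul_nonneg ?_ ?_) ⟨(j - (d - 1), min j (d - 1)), ?_, ?_⟩
  · rw [coeff_geom_sum]; split_ifs <;> norm_num
  · rcases lt_or_ge x.2 d with h2 | h2
    · exact (hf _ h2).le
    · rw [coeff_eq_zero_of_natDegree_lt (by omega)]
  · rw [Finset.HasAntidiagonal.mem_antidiagonal]; omega
  · rw [coeff_geom_sum, if_pos (by omega), one_mul]
    exact hf _ (by omega)

theorem natDegree_geom_sum_mul_lt {h d : ℕ} (hh : 0 < h) (f : ℝ[X]) (hd : f.natDegree < d) :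
    ((∑ i ∈ Finset.range h, X ^ i) * f).natDegree < h + d - 1 := by
  have h1 : (∑ i ∈ Finset.range h, (X : ℝ[X]) ^ i).natDegree ≤ h - 1 :=
    natDegree_le_iff_coeff_eq_zero.2 fun j hj => by rw [coeff_geom_sum, if_neg (by omega)]
  have := natDegree_mul_le (p := ∑ i ∈ Finset.range h, (X : ℝ[X]) ^ i) (q := f)
  omega

theorem aeval_geom_sum_eq_zero {h : ℕ} {z : ℂ} (hz : z ^ h = 1) (hz1 : z ≠ 1) :
    aeval z (∑ i ∈ Finset.range h, (X : ℝ[X]) ^ i) = 0 := by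
  have := geom_sum_mul z h
  rw [hz, sub_self] at this
  simpa using (mul_eq_zero.1 this).resolve_right (sub_ne_zero.2 hz1)

/-- `gaussPoly` at `-X`, as a complex polynomial. -/
noncomputable def alternatingGaussPoly (h M : ℕ) : ℂ[X] :=
  ((gaussPoly h M).map (algebraMap ℝ ℂ)).comp (C (-1) * X)

theorem coeff_alternatingGaussPoly (h M j : ℕ) :
    (alternatingGaussPoly h M).coeff j = (-1) ^ j * gaussCoeff h M j := by
  rw [alternatingGaussPoly, comp_C_mul_X_coeff, coeff_map, coeff_gaussPoly, mul_comm]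
  rfl

theorem natDegree_alternatingGaussPoly_le (h M : ℕ) : (alternatingGaussPoly h M).natDegree ≤ M :=
  natDegree_le_iff_coeff_eq_zero.2 fun j hj => by
    rw [coeff_alternatingGaussPoly, gaussCoeff_eq_zero h M j hj, Complex.ofReal_zero, mul_zero]

theorem eval_alternatingGaussPoly (h M : ℕ) (z : ℂ) :
    (alternatingGaussPoly h M).eval z = aeval (-z) (gaussPoly h M) := by
  simp [alternatingGaussPoly, eval_comp, eval_map_algebraMap]

/-- A minimum size unextendible product basis for an odd dimension and a larger even one. -/
theorem attains_odd_even {h s : ℕ} (hs : 0 < s) (hsh : 2 * s < h) :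
    Attains (2 * s + 1) (2 * h - 2 * s) (2 * s * (2 * h - 2 * s - 1)) := by
  have hh : 0 < h := by omega
  have hd : (gaussPoly h (h - 2 * s)).natDegree < h - 2 * s + 1 :=
    Nat.lt_succ_of_le (natDegree_gaussPoly_le _ _)
  have hpos : ∀ j < h - 2 * s + 1, 0 < (gaussPoly h (h - 2 * s)).coeff j := fun j hj => by
    rw [coeff_gaussPoly]
    exact gaussCoeff_pos (by omega) j (by omega)
  refine attains_of_polynomials hh (by omega) (by omega) (by omega) ?_
    (alternatingGaussPoly h (2 * s)) ((∑ i ∈ Finset.range h, X ^ i) * gaussPoly h (h - 2 * s))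
    (Nat.lt_succ_of_le (natDegree_alternatingGaussPoly_le _ _)) (fun j hj => ?_) ?_ (fun j hj => ?_)
    (fun z hz hz1 => ?_) (fun z hz => ?_)
  · obtain ⟨d, rfl⟩ := Nat.exists_eq_add_of_lt hsh
    rw [show 2 * (2 * s + d + 1) - 2 * s - 1 = 2 * s + 2 * d + 1 by omega,
      show 2 * (2 * s + d + 1) - 2 * s = 2 * s + 2 * d + 2 by omega]
    ring
  · rw [coeff_alternatingGaussPoly]
    refine mul_ne_zero (pow_ne_zero _ (by norm_num)) ?_
    exact_mod_cast (gaussCoeff_pos hsh j (by omega)).ne'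
  · have := natDegree_geom_sum_mul_lt hh _ hd
    omega
  · exact coeff_geom_sum_mul_pos hh _ hpos hd (by omega)
  · rw [map_mul, aeval_geom_sum_eq_zero hz hz1, zero_mul]
  · rw [eval_alternatingGaussPoly, map_mul]
    exact (aeval_gaussPoly_eq_zero_or hs hsh hz).imp_right fun h0 => by rw [h0, mul_zero]

/-- For odd `M` the Gaussian polynomial is divisible by `X + 1`, with positive quotient. -/
theorem exists_gaussPoly_eq_mul {h M : ℕ} (hM : M + 1 < h) (hodd : Odd M) :
    ∃ g : ℝ[X], gaussPoly h M = (X + C 1) * g ∧ g.natDegree < M ∧ ∀ j < M, 0 < g.coeff j := by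
  obtain ⟨t, rfl⟩ := hodd
  set f := gaussPoly h (2 * t + 1) with hf
  have hroot : f.eval (-1) = 0 := by
    have := aeval_gaussPoly_eq_zero (by omega : 2 * t + 1 < h) t (by omega) (-1) (by ring)
    have h2 : aeval ((-1 : ℝ) : ℂ) f = ((f.eval (-1) : ℝ) : ℂ) :=
      aeval_algebraMap_apply_eq_algebraMap_eval (A := ℂ) (-1) f
    push_cast at h2
    rw [h2] at this
    exact_mod_cast this
  obtain ⟨g, hg⟩ := dvd_iff_isRoot.2 hroot
  rw [C_neg, sub_neg_eq_add] at hg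
  have hf0 : f ≠ 0 := fun h0 => by
    have : f.coeff 0 = 1 := coeff_gaussPoly _ _ _
    rw [h0, coeff_zero] at this
    exact zero_ne_one this
  have hg0 : g ≠ 0 := fun h0 => hf0 (by rw [hg, h0, mul_zero])
  have hgd : g.natDegree < 2 * t + 1 := by
    have h1 := natDegree_gaussPoly_le h (2 * t + 1)
    rw [← hf, hg, natDegree_mul (X_add_C_ne_zero 1) hg0, natDegree_X_add_C] at h1
    omega
  refine ⟨g, hg, hgd, ?_⟩
  have hr : ∀ j ≤ 2 * t + 1, 0 < f.coeff j := fun j hj => by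
    rw [hf, coeff_gaussPoly]
    exact gaussCoeff_pos (by omega) j hj
  have hr1 : ∀ j < t, f.coeff j < f.coeff (j + 1) := fun j hj => by
    rw [hf, coeff_gaussPoly, coeff_gaussPoly]
    exact gaussCoeff_lt_succ hM (by omega)
  have hr2 : ∀ j, t < j → j < 2 * t + 1 → f.coeff (j + 1) < f.coeff j := fun j hj hj' => by
    rw [hf, coeff_gaussPoly, coeff_gaussPoly]
    exact gaussCoeff_succ_lt hM (by omega) (by omega)
  have h0 : f.coeff 0 = g.coeff 0 := by rw [hg]; simp
  have hrec : ∀ j, f.coeff (j + 1) = g.coeff j + g.coeff (j + 1) := fun j => by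
    rw [hg, add_mul, coeff_add, coeff_X_mul, C_1, one_mul]
  have up : ∀ j, (j ≤ t → 0 < g.coeff j) ∧ (j + 1 ≤ t → 0 < g.coeff (j + 1)) := by
    intro j
    induction j with
    | zero =>
      refine ⟨fun _ => h0 ▸ hr 0 (by omega), fun h1 => ?_⟩
      linarith [hrec 0, hr1 0 h1]
    | succ j ih =>
      refine ⟨ih.2, fun h1 => ?_⟩
      linarith [hrec j, hrec (j + 1), hr1 (j + 1) h1, ih.1 (by omega)]
  have htop : g.coeff (2 * t + 1) = 0 := coeff_eq_zero_of_natDegree_lt hgd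
  have down : ∀ d, (d < t → 0 < g.coeff (2 * t - d)) ∧ (d + 1 < t → 0 < g.coeff (2 * t - (d + 1))) := by
    intro d
    induction d with
    | zero =>
      have hlast : g.coeff (2 * t) = f.coeff (2 * t + 1) := by rw [hrec, htop, add_zero]
      refine ⟨fun _ => ?_, fun h1 => ?_⟩
      · rw [Nat.sub_zero, hlast]; exact hr _ le_rfl
      · obtain ⟨e, he⟩ : ∃ e, 2 * t = e + 1 := ⟨2 * t - 1, by omega⟩
        have := hr2 (2 * t) (by omega) (by omega)
        have h3 := hrec e
        rw [← he] at h3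
        rw [show 2 * t - (0 + 1) = e by omega]
        linarith
    | succ d ih =>
      refine ⟨ih.2, fun h1 => ?_⟩
      obtain ⟨e, he⟩ : ∃ e, 2 * t - d = e + 2 := ⟨2 * t - d - 2, by omega⟩
      have h2 := ih.1 (by omega)
      rw [he] at h2
      rw [show 2 * t - (d + 1 + 1) = e by omega]
      linarith [hrec e, hrec (e + 1), hr2 (e + 1) (by omega) (by omega)]
  intro j hj
  rcases le_or_gt j t with h1 | h1
  · exact (up j).1 h1
  · have := (down (2 * t - j)).1 (by omega)
    rwa [show 2 * t - (2 * t - j) = j by omega] at this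

/-- A minimum size unextendible product basis for an even dimension and a larger odd one, in one
residue class modulo `4`. -/
theorem attains_even_odd {h s : ℕ} (hs : 0 < s) (hsh : 2 * s + 1 < h) (hodd : Odd h) :
    Attains (2 * s + 2) (2 * h - 2 * s - 1) ((2 * s + 1) * (2 * h - 2 * s - 2)) := by
  have hh : 0 < h := by omega
  obtain ⟨g, hg, hd, hpos⟩ := exists_gaussPoly_eq_mul (h := h) (M := h - 2 * s) (by omega)
    (Nat.Odd.sub_even (by omega) hodd (even_two_mul s))
  refine attains_of_polynomials hh (by omega) (by omega) (by omega) ?_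
    ((X + C 1) * alternatingGaussPoly h (2 * s)) ((∑ i ∈ Finset.range h, X ^ i) * g)
    ?_ (fun j hj => ?_) ?_ (fun j hj => ?_) (fun z hz hz1 => ?_) (fun z hz => ?_)
  · obtain ⟨d, rfl⟩ := Nat.exists_eq_add_of_lt hsh
    rw [show 2 * (2 * s + 1 + d + 1) - 2 * s - 1 = 2 * s + 2 * d + 3 by omega,
      show 2 * (2 * s + 1 + d + 1) - 2 * s - 2 = 2 * s + 2 * d + 2 by omega]
    ring
  · have h1 := natDegree_mul_le (p := (X + C 1 : ℂ[X])) (q := alternatingGaussPoly h (2 * s))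
    have h2 := natDegree_alternatingGaussPoly_le h (2 * s)
    rw [natDegree_X_add_C] at h1
    omega
  · rcases j with _ | j
    · simp [coeff_alternatingGaussPoly, gaussCoeff]
    · rw [add_mul, coeff_add, coeff_X_mul, C_1, one_mul, coeff_alternatingGaussPoly,
        coeff_alternatingGaussPoly]
      have hne : gaussCoeff h (2 * s) j - gaussCoeff h (2 * s) (j + 1) ≠ 0 := by
        rw [sub_ne_zero]
        rcases lt_trichotomy j s with h1 | h1 | h1
        · exact (gaussCoeff_lt_succ hsh (by omega)).ne
        · exact (gaussCoeff_succ_lt hsh (by omega) (by omega)).ne'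
        · rcases (by omega : j < 2 * s ∨ j = 2 * s) with h2 | h2
          · exact (gaussCoeff_succ_lt hsh (by omega) h2).ne'
          · rw [gaussCoeff_eq_zero h _ (j + 1) (by omega)]
            exact (gaussCoeff_pos (by omega) j h2.le).ne'
      have : (-1 : ℂ) ^ j * (gaussCoeff h (2 * s) j : ℂ) +
          (-1) ^ (j + 1) * (gaussCoeff h (2 * s) (j + 1) : ℂ) = (-1) ^ j *
            ((gaussCoeff h (2 * s) j - gaussCoeff h (2 * s) (j + 1) : ℝ) : ℂ) := by
        push_cast
        ring
      rw [this]
      exact mul_ne_zero (pow_ne_zero _ (by norm_num)) (by exact_mod_cast hne)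
  · have := natDegree_geom_sum_mul_lt hh _ hd
    omega
  · exact coeff_geom_sum_mul_pos hh _ hpos hd (by omega)
  · rw [map_mul, aeval_geom_sum_eq_zero hz hz1, zero_mul]
  · rw [eval_mul, eval_alternatingGaussPoly, map_mul, mul_eq_zero, mul_eq_zero]
    by_cases h1 : z + 1 = 0
    · left; left; simpa using h1
    · refine (aeval_gaussPoly_eq_zero_or hs (by omega) hz).imp Or.inr fun h0 => Or.inr ?_
      rw [hg, map_mul, mul_eq_zero] at h0
      exact h0.resolve_left (by simpa using h1)

theorem attains_three_four_of_le {l : ℕ} (hl : 4 ≤ l) (hl' : l ≤ 6) : Attains 3 4 l := by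
  interval_cases l
  · exact attains_three_three.mono (by norm_num) (by norm_num) le_rfl (by norm_num)
  · exact attains_three_four
  · exact attains_odd_even (h := 3) (s := 1) (by norm_num) (by norm_num)

theorem attains_three_seven {l : ℕ} (hl : 4 ≤ l) (hl' : l ≤ 10) (h7 : l ≠ 7) : Attains 3 7 l := by
  rcases le_or_gt l 6 with h | h
  · exact (attains_three_four_of_le hl h).mono (by norm_num) (by norm_num) le_rfl (by norm_num)
  · obtain ⟨k, rfl⟩ : ∃ k, l = 4 + k := Nat.exists_eq_add_of_le hl
    exact attains_three_three.add_cols (by norm_num)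
      (attains_three_four_of_le (by omega) (by omega))

theorem attains_three_eight {l : ℕ} (hl : 4 ≤ l) (hl' : l ≤ 12) (h7 : l ≠ 7) : Attains 3 8 l := by
  rcases le_or_gt l 10 with h | h
  · exact (attains_three_seven hl h h7).mono (by norm_num) (by norm_num) le_rfl (by norm_num)
  · obtain ⟨k, rfl⟩ : ∃ k, l = 6 + k := Nat.exists_eq_add_of_le (by omega)
    exact (attains_three_four_of_le (by norm_num) le_rfl).add_cols (by norm_num)
      (attains_three_four_of_le (by omega) (by omega))

/-- Stacking blocks of three rows. -/
theorem attains_row_blocks {n c : ℕ} (hn : 0 < n) (hc : 10 ≤ c) (hc' : c ≤ 12)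
    (H : ∀ l, 4 ≤ l → l ≤ c → l ≠ 7 → Attains 3 n l) (t : ℕ) :
    ∀ l, 4 ≤ l → l ≤ c * t → l ≠ 7 → Attains (3 * t) n l := by
  induction t with
  | zero => intro l hl hl'; omega
  | succ t ih =>
    intro l hl hl' h7
    rw [mul_add, mul_one] at hl' ⊢
    rw [add_comm]
    rcases le_or_gt l c with h | h
    · exact (H l hl h h7).mono (by norm_num) hn (by omega) le_rfl
    have ht : 0 < t := by
      rcases Nat.eq_zero_or_pos t with rfl | ht
      · omega
      · exact ht
    have hct : c ≤ c * t := Nat.le_mul_of_pos_right c ht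
    obtain ⟨x, y, rfl, hx, hxc, hx7, hy, hyc, hy7⟩ : ∃ x y, l = x + y ∧ 4 ≤ x ∧ x ≤ c ∧ x ≠ 7 ∧
        4 ≤ y ∧ y ≤ c * t ∧ y ≠ 7 := by
      by_cases h1 : l ≤ c + 3
      · rcases (by omega : l = 11 ∨ l = 12 ∨ l = 13 ∨ l = 14 ∨ l = 15) with h | h | h | h | h
        · exact ⟨5, 6, by omega⟩
        · exact ⟨6, 6, by omega⟩
        · exact ⟨5, 8, by omega⟩
        · exact ⟨6, 8, by omega⟩
        · exact ⟨6, 9, by omega⟩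
      · by_cases h2 : l = c + 7
        · exact ⟨c - 1, 8, by omega⟩
        · exact ⟨c, l - c, by omega⟩
    exact (H x hx hxc hx7).add_rows hn (ih y hy hyc hy7)

theorem attains_seven_cols {m l : ℕ} (hm : 4 ≤ m) (hl : 4 ≤ l) (hl' : l ≤ 10 * (m / 3)) :
    Attains m 7 l := by
  by_cases h7 : l = 7
  · subst h7
    exact attains_four_four.mono (by norm_num) (by norm_num) hm (by norm_num)
  · exact (attains_row_blocks (by norm_num) le_rfl (by norm_num)
      (fun _ => attains_three_seven) (m / 3) l hl hl' h7).mono (by omega) (by norm_num) (by omega)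
      le_rfl

theorem attains_eight_cols {m l : ℕ} (hm : 4 ≤ m) (hl : 4 ≤ l) (hl' : l ≤ 12 * (m / 3)) :
    Attains m 8 l := by
  by_cases h7 : l = 7
  · subst h7
    exact attains_four_four.mono (by norm_num) (by norm_num) hm (by norm_num)
  · exact (attains_row_blocks (by norm_num) (by norm_num) le_rfl
      (fun _ => attains_three_eight) (m / 3) l hl hl' h7).mono (by omega) (by norm_num) (by omega)
      le_rfl

theorem attains_odd_rows {m q : ℕ} (hm : Odd m) (hm3 : 3 ≤ m) (hq : Odd q) (hmq : m ≤ q) :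
    Attains m (q + 1) ((m - 1) * q) := by
  obtain ⟨s, rfl⟩ := hm
  obtain ⟨t, rfl⟩ := hq
  have := attains_odd_even (h := s + t + 1) (s := s) (by omega) (by omega)
  rwa [show 2 * (s + t + 1) - 2 * s - 1 = 2 * t + 1 by omega,
    show 2 * (s + t + 1) - 2 * s = 2 * t + 1 + 1 by omega] at this

theorem attains_even_rows_of_lt {m q : ℕ} (hm : Even m) (hq : Even q) (hq2 : 2 ≤ q) (hqm : q < m) :
    Attains m (q + 1) ((m - 1) * q) := by
  obtain ⟨s, rfl⟩ := hq
  obtain ⟨t, rfl⟩ := hm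
  have := attains_odd_even (h := s + t) (s := s) (by omega) (by omega)
  rw [show 2 * (s + t) - 2 * s = t + t by omega, two_mul, mul_comm] at this
  exact this.swap

theorem attains_even_rows_of_mod {m q : ℕ} (hm4 : 4 ≤ m) (hm : Even m) (hmq : m ≤ q)
    (hmod : (m + q) % 4 = 2) : Attains m (q + 1) ((m - 1) * q) := by
  obtain ⟨t, rfl⟩ := hm
  obtain ⟨s, rfl⟩ : ∃ s, t = s + 1 := ⟨t - 1, by omega⟩
  obtain ⟨h, hh⟩ : ∃ h, s + 1 + (s + 1) + q = 2 * h := ⟨(s + 1 + (s + 1) + q) / 2, by omega⟩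
  have := attains_even_odd (h := h) (s := s) (by omega) (by omega) (Nat.odd_iff.2 (by omega))
  convert this using 1
  · omega
  · omega
  · congr 1 <;> omega

theorem attains_even_rows {m q : ℕ} (hm4 : 4 ≤ m) (hm : Even m) (hq : Even q) :
    Attains m (q + 2) ((m - 1) * q) := by
  have hm2 := Nat.even_iff.1 hm
  have hq2 := Nat.even_iff.1 hq
  rcases Nat.eq_zero_or_pos q with rfl | hq0
  · exact Attains.zero _ _
  rcases lt_or_ge q m with hqm | hqm
  · exact (attains_even_rows_of_lt hm hq (by omega) hqm).mono (by omega) (by omega) le_rfl (by omega)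
  by_cases hmod : (m + q) % 4 = 2
  · exact (attains_even_rows_of_mod hm4 hm hqm hmod).mono (by omega) (by omega) le_rfl (by omega)
  obtain ⟨p, rfl⟩ : ∃ p, q = p + 2 := ⟨q - 2, by omega⟩
  have hp : Attains m (p + 1) ((m - 1) * p) := by
    rcases lt_or_ge p m with hpm | hpm
    · exact attains_even_rows_of_lt hm (Nat.even_iff.2 (by omega)) (by omega) hpm
    · exact attains_even_rows_of_mod hm4 hm hpm (by omega)
  rw [mul_add, show p + 2 + 2 = p + 1 + (2 + 1) by omega]
  exact hp.add_cols (by omega) (attains_even_rows_of_lt hm even_two le_rfl (by omega))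

theorem attains_of_even {m n l : ℕ} (hm4 : 4 ≤ m) (hm : Even m) (hn : 10 ≤ n) (hl : 4 ≤ l)
    (hl' : l ≤ (m - 1) * (n - 8)) : Attains m n l := by
  have hm2 := Nat.even_iff.1 hm
  set t := (l - 4) / (2 * (m - 1)) with ht
  have hdm := Nat.div_add_mod (l - 4) (2 * (m - 1))
  have hlt := Nat.mod_lt (l - 4) (by omega : 0 < 2 * (m - 1))
  rw [← ht, show 2 * (m - 1) * t = (m - 1) * (2 * t) by ring] at hdm
  have hq : 2 * t < n - 8 := Nat.lt_of_mul_lt_mul_left (a := m - 1) (by omega)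
  obtain ⟨r, hr⟩ : ∃ r, l = (m - 1) * (2 * t) + r := Nat.exists_eq_add_of_le (by omega)
  have hm3 : 2 * m + 1 ≤ 10 * (m / 3) := by
    rcases hm4.eq_or_lt with rfl | hm5
    · norm_num
    · have : 6 ≤ m := by omega
      omega
  rw [hr]
  exact ((attains_even_rows hm4 hm (even_two_mul t)).add_cols (by omega)
    (attains_seven_cols hm4 (by omega) (by omega))).mono (by omega) (by omega) le_rfl (by omega)

theorem attains_of_odd {m n l : ℕ} (hm5 : 5 ≤ m) (hm : Odd m) (hn : 10 ≤ n) (hl : 4 ≤ l)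
    (hl' : l ≤ (m - 1) * (n - 8)) : Attains m n l := by
  obtain ⟨a, rfl⟩ : ∃ a, m = 2 * a + 1 := hm
  rw [show 2 * a + 1 - 1 = 2 * a by omega] at hl'
  have heven : Even (2 * a) := even_two_mul a
  by_cases h1 : l ≤ (2 * a - 1) * (n - 8)
  · exact (attains_of_even (by omega) heven hn hl h1).mono (by omega) (by omega) (by omega) le_rfl
  by_cases h2 : 2 * a * (2 * a + 1) + 4 ≤ l
  · set t := (l - 4 - 2 * a) / (4 * a) with ht
    have hdm := Nat.div_add_mod (l - 4 - 2 * a) (4 * a)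
    have hlt := Nat.mod_lt (l - 4 - 2 * a) (by omega : 0 < 4 * a)
    have hta : a ≤ t := by
      rw [ht, Nat.le_div_iff_mul_le (by omega)]
      have : 2 * a * (2 * a + 1) = a * (4 * a) + 2 * a := by ring
      omega
    have e1 : 4 * a * t + 2 * a = 2 * a * (2 * t + 1) := by ring
    have e2 : 2 * a * (2 * a + 1) = 2 * a * (2 * a) + 2 * a := by ring
    rw [← ht] at hdm
    have hq : 2 * t + 1 < n - 8 := Nat.lt_of_mul_lt_mul_left (a := 2 * a) (by omega)
    obtain ⟨r, hr⟩ : ∃ r, l = (2 * a + 1 - 1) * (2 * t + 1) + r :=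
      Nat.exists_eq_add_of_le (by rw [Nat.add_sub_cancel]; omega)
    rw [hr]
    rw [Nat.add_sub_cancel] at hr
    exact ((attains_odd_rows (odd_two_mul_add_one a) (by omega) (odd_two_mul_add_one t)
      (by omega)).add_cols (by omega) (attains_eight_cols (by omega) (by omega) (by omega))).mono
      (by omega) (by omega) le_rfl (by omega)
  · obtain ⟨N, rfl⟩ : ∃ N, n = N + 8 := ⟨n - 8, by omega⟩
    rw [Nat.add_sub_cancel] at hl' h1
    obtain ⟨b, rfl⟩ : ∃ b, a = b + 1 := ⟨a - 1, by omega⟩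
    rw [show 2 * (b + 1) - 1 = 2 * b + 1 by omega] at h1
    have hN : N ≤ 2 * b + 5 := by
      by_contra! hN
      have : (2 * b + 1) * (2 * b + 6) ≤ (2 * b + 1) * N := Nat.mul_le_mul_left _ hN
      nlinarith
    have hrows : ∀ q, Even q → Attains (2 * (b + 1) + 1) (q + 2) ((2 * b + 1) * q) := fun q hq =>
      (attains_even_rows (m := 2 * (b + 1)) (by omega) heven hq).mono (by omega) (by omega)
        (by omega) le_rfl
    have e : 2 * (b + 1) * N = (2 * b + 1) * N + N := by ring
    rcases Nat.even_or_odd N with ⟨c, hc⟩ | ⟨c, hc⟩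
    · obtain ⟨q, rfl⟩ : ∃ q, N = q + 2 := ⟨N - 2, by omega⟩
      rw [mul_add (2 * b + 1)] at e h1
      obtain ⟨r, rfl⟩ : ∃ r, l = (2 * b + 1) * q + r := Nat.exists_eq_add_of_le (by omega)
      exact ((hrows q (Nat.even_iff.2 (by omega))).add_cols (by omega)
        (attains_eight_cols (by omega) (by omega) (by omega))).mono (by omega) (by omega) le_rfl
        (by omega)
    · obtain ⟨q, rfl⟩ : ∃ q, N = q + 1 := ⟨N - 1, by omega⟩
      rw [mul_add (2 * b + 1)] at e h1
      obtain ⟨r, rfl⟩ : ∃ r, l = (2 * b + 1) * q + r := Nat.exists_eq_add_of_le (by omega)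
      exact ((hrows q (Nat.even_iff.2 (by omega))).add_cols (by omega)
        (attains_seven_cols (by omega) (by omega) (by omega))).mono (by omega) (by omega) le_rfl
        (by omega)

theorem corollary2 (m n : ℕ) (hm : 4 ≤ m) (hn : 10 ≤ n) (l : ℕ) (hl : 4 ≤ l)
    (hl' : l ≤ (m - 1) * (n - 8)) : ExistsUPBWithMissing m n l := by
  refine Attains.existsUPBWithMissing (by omega) ?_
  rcases Nat.even_or_odd m with h | h
  · exact attains_of_even hm h hn hl hl'
  · have := Nat.odd_iff.1 h
    exact attains_of_odd (by omega) h hn hl hl'
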